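/- **Definitions.** An *FO learning framework* is a pair $\mathfrak F=(\mathcal E,\mathcal L)$ of a non-empty set $\mathcal E$ of first-order sentences (the examples) and a non-empty set $\mathcal L$ of finite sets of first-order sentences (FO knowledge bases, KBs; the hypothesis space), all over a countable signature, such that any two logically non-equivalent KBs in $\mathcal L$ differ on the entailment of some example. A *possibilistic formula* is a pair $(\varphi,\alpha)$ of a sentence $\varphi$ and a real number $\alpha\in(0,1]$ with a finite decimal expansion. A possibility distribution $\pi$ maps interpretations to $[0,1]$; it satisfies $(\varphi,\alpha)$ if $1-\sup\{\pi(\mathcal I)\mid \mathcal I\models\neg\varphi\}\ge\alpha$ (where $\sup\emptyset=0$), and a finite set $k$ of possibilistic formulas entails $(\varphi,\alpha)$ if every $\pi$ that satisfies all members of $k$ satisfies $(\varphi,\alpha)$. Let $\mathfrak F$ be formulated in a language $L$, that is, let $L$ be a set of sentences that contains $\mathcal E$ and all members of KBs in $\mathcal L$. The *possibilistic extension* of $\mathfrak F$ is $\mathfrak F_\pi=(\mathcal E_\pi,\mathcal L_\pi)$, where $\mathcal L_\pi$ consists of all sets $\{(\varphi,v(\varphi))\mid\varphi\in l\}$ with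 $l\in\mathcal L$ and $v$ an assignment of valuations to sentences, and $\mathcal E_\pi$ consists of all possibilistic formulas $(\varphi,\alpha)$ with $\varphi\in L$ that are entailed by some element of $\mathcal L_\pi$. Given a target $t$ in the hypothesis space, a membership query asks whether $t\models e$ for an example $e$; an equivalence query asks whether $h\equiv t$ for an $h$ in the hypothesis space and is answered by "yes", or else by an arbitrary counterexample, that is, an example entailed by exactly one of $t$ and $h$. A framework is *polynomial time learnable* if there are a deterministic Turing machine with access to both oracles and a polynomial $p$ such that, for every target $t$ and all oracles for $t$, the machine, given the finite set of non-logical symbols of $t$ as input, poses only admissible queries, halts and outputs an element $h\equiv t$ of the hypothesis space, and at every step of the computation the time used so far (not counting the time of the oracles) is at most $p(|t|,|e|)$, where $e$ is the largest counterexample seen so far ($|e|=0$ if there is none). PTimeL is the class of the frameworks that are polynomial time learnable and whose entailment problem (given $l$ in the hypothesis space and an example $e$, does $l\models e$ hold?) is solvable in polynomial time. **Theorem.** There exists an FO learning framework $\mathfrak F$ such that $\mathfrak F$ is in PTimeL but its possibilistic extension $\mathfrak F_\pi$ is not in PTimeL, whichever language $L$ the framework $\mathfrak F$ is taken to be formulated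 in; in fact $\mathfrak F_\pi$ is not even polynomial time learnable. -/

import Mathlib

namespace PossLearn

/-! Words over a fixed finite alphabet; every object is presented to a machine as a word. -/

/-- The alphabet: decimal digits, an end-of-number mark, one mark for each constructor of the
first-order syntax, a separator, and the two oracle verdicts. -/
inductive Symb where
  | dig (d : Fin 10)
  | fin | var | fn | bot | eq | rel | imp | all | sep | yes | no
  deriving DecidableEq, Fintype

abbrev Word := List Symb

/-! ## Deterministic multi-tape Turing machines, with oracle queries -/

inductive Move where
  | left | stay | right

/-- A two-way infinite tape: `left` is the part to the left of the head (nearest cell first),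
`right` starts with the scanned cell. Cells that are not listed are blank, blank being `none`. -/
structure Tape where
  left : List (Option Symb)
  right : List (Option Symb)

namespace Tape

/-- The tape that holds `w`, with the head on its first symbol. -/
def ofWord (w : Word) : Tape := ⟨[], w.map some⟩

def read (T : Tape) : Option Symb := T.right.head?.join

def write (c : Option Symb) (T : Tape) : Tape := ⟨T.left, c :: T.right.tail⟩

def move : Move → Tape → Tape
  | .stay, T => T
  | .left, T => ⟨T.left.tail, T.left.head?.join :: T.right⟩
  | .right, T => ⟨T.read :: T.left, T.right.tail⟩

/-- The word that starts at the head and ends before the first blank. -/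
def word (T : Tape) : Word := (T.right.takeWhile Option.isSome).reduceOption

end Tape

/-- What a machine with state set `S` and `k` tapes does in one step: write a symbol on each tape,
move each head and change the state; or pose a query of kind `q` and continue in a new state; or
halt. -/
inductive Instr (Q S : Type) (k : ℕ) where
  | act (s : S) (w : Fin k → Option Symb × Move)
  | query (q : Q) (s : S)
  | halt

/-- A deterministic Turing machine with finitely many states and finitely many tapes, which may pose
queries of the kinds in `Q`. Tape `0` initially holds the input. Tape `1` is the communication tape:
it holds the query when a query is posed, then the answer, and finally the output. -/
structure Machine (Q : Type) where
  extra : ℕ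
  State : Type
  [finite : Finite State]
  start : State
  next : State → (Fin (extra + 2) → Option Symb) → Instr Q State (extra + 2)

/-- A configuration, together with the list of the queries posed so far, latest first (this record
is not visible to the machine). -/
structure Config {Q : Type} (M : Machine Q) where
  state : M.State
  tapes : Fin (M.extra + 2) → Tape
  asked : List (Q × Word)

namespace Machine

variable {Q : Type} (M : Machine Q)

def init (input : Word) : Config M where
  state := M.start
  tapes i := if i = 0 then Tape.ofWord input else Tape.ofWord []
  asked := []

/-- The instruction executed in a configuration. -/
def instr (c : Config M) : Instr Q M.State (M.extra + 2) :=
  M.next c.state fun i => (c.tapes i).read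

/-- One step. A query costs one step: the oracle `O` replaces the query by its answer. A halted
configuration does not change any more. -/
def step (O : Q → Word → Word) (c : Config M) : Config M :=
  match M.instr c with
  | .act s w => ⟨s, fun i => ((c.tapes i).write (w i).1).move (w i).2, c.asked⟩
  | .query q s => ⟨s, Function.update c.tapes 1 (Tape.ofWord (O q (c.tapes 1).word)),
      (q, (c.tapes 1).word) :: c.asked⟩
  | .halt => c

/-- The configuration after `n` steps on the given input. -/
def run (O : Q → Word → Word) (input : Word) (n : ℕ) : Config M :=
  (M.step O)^[n] (M.init input)

def Halted (c : Config M) : Prop := M.instr c = .halt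

def output (c : Config M) : Word := (c.tapes 1).word

end Machine

/-! ## First-order formulas and their codes -/

/-- The countable first-order language with countably many function symbols and countably many
relation symbols of every arity (relation symbols of arity `0` are propositional variables). -/
abbrev lang : FirstOrder.Language.{0, 0} := ⟨fun _ => ℕ, fun _ => ℕ⟩

abbrev Sentence := lang.Sentence

/-- Decimal notation, least significant digit first, with an end mark. -/
def numCode (n : ℕ) : Word := ((Nat.digits 10 n).map fun d => Symb.dig (Fin.ofNat 10 d)) ++ [.fin]

def symbolCode : lang.Symbols → Word
  | .inl ⟨n, i⟩ => .fn :: (numCode n ++ numCode i)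
  | .inr ⟨n, i⟩ => .rel :: (numCode n ++ numCode i)

/-- Prefix notation. -/
def termCode {n : ℕ} : lang.Term (Empty ⊕ Fin n) → Word
  | .var (.inl e) => e.elim
  | .var (.inr i) => .var :: numCode i
  | .func (l := l) f ts =>
      symbolCode (.inl ⟨l, f⟩) ++ (List.ofFn fun i => termCode (ts i)).flatten

/-- Prefix notation. -/
def formCode : {n : ℕ} → lang.BoundedFormula Empty n → Word
  | _, .falsum => [.bot]
  | _, .equal t u => .eq :: (termCode t ++ termCode u)
  | _, .rel (l := l) R ts =>
      symbolCode (.inr ⟨l, R⟩) ++ (List.ofFn fun i => termCode (ts i)).flatten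
  | _, .imp f g => .imp :: (formCode f ++ formCode g)
  | _, .all f => .all :: formCode f

/-- The non-logical symbols that occur in a term. -/
def termSymbols {n : ℕ} : lang.Term (Empty ⊕ Fin n) → List lang.Symbols
  | .var _ => []
  | .func (l := l) f ts => .inl ⟨l, f⟩ :: (List.ofFn fun i => termSymbols (ts i)).flatten

/-- The non-logical symbols that occur in a formula. -/
def formSymbols : {n : ℕ} → lang.BoundedFormula Empty n → List lang.Symbols
  | _, .falsum => []
  | _, .equal t u => termSymbols t ++ termSymbols u
  | _, .rel (l := l) R ts => .inr ⟨l, R⟩ :: (List.ofFn fun i => termSymbols (ts i)).flatten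
  | _, .imp f g => formSymbols f ++ formSymbols g
  | _, .all f => formSymbols f

/-! ### Unique readability -/

theorem append_mark_inj {a b u v : Word} (s : Symb) (ha : s ∉ a) (hb : s ∉ b)
    (h : a ++ s :: u = b ++ s :: v) : a = b ∧ u = v := by
  induction a generalizing b with
  | nil =>
    cases b with
    | nil => simpa using h
    | cons y b => simp at h hb; exact absurd h.1 hb.1
  | cons x a ih =>
    cases b with
    | nil => simp at h ha; exact absurd h.1.symm ha.1
    | cons y b =>
      simp only [List.cons_append, List.cons.injEq, List.mem_cons, not_or] at h ha hb
      obtain ⟨h1, h2⟩ := ih ha.2 hb.2 h.2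
      exact ⟨by rw [h.1, h1], h2⟩

theorem numCode_inj {m n : ℕ} {u v : Word} (h : numCode m ++ u = numCode n ++ v) :
    m = n ∧ u = v := by
  simp only [numCode, List.append_assoc, List.singleton_append] at h
  obtain ⟨h1, h2⟩ := append_mark_inj .fin (by simp) (by simp) h
  refine ⟨?_, h2⟩
  have key : ∀ k : ℕ, ((Nat.digits 10 k).map fun d => Symb.dig (Fin.ofNat 10 d)).map
      (fun s => match s with | .dig d => d.val | _ => 0) = Nat.digits 10 k := by
    intro k
    rw [List.map_map]
    conv_rhs => rw [← List.map_id (Nat.digits 10 k)]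
    apply List.map_congr_left
    intro d hd
    simpa using Nat.digits_lt_base (by norm_num) hd
  apply Nat.digits_inj_iff (b := 10) |>.1
  rw [← key m, ← key n, h1]

theorem symbolCode_inj {s t : lang.Symbols} {u v : Word}
    (h : symbolCode s ++ u = symbolCode t ++ v) : s = t ∧ u = v := by
  rcases s with ⟨m, i⟩ | ⟨m, i⟩ <;> rcases t with ⟨n, j⟩ | ⟨n, j⟩ <;>
    simp only [symbolCode, List.cons_append, List.cons.injEq, List.append_assoc, true_and,
      reduceCtorEq, false_and] at h
  all_goals
    obtain ⟨rfl, h'⟩ := numCode_inj h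
    obtain ⟨h1, h2⟩ := numCode_inj h'
    cases h1
    exact ⟨rfl, h2⟩

theorem ofFn_flatten_inj {α : Type} (c : α → Word) {k : ℕ} (f g : Fin k → α)
    (hc : ∀ i b u v, c (f i) ++ u = c b ++ v → f i = b ∧ u = v) {u v : Word}
    (h : (List.ofFn fun i => c (f i)).flatten ++ u = (List.ofFn fun i => c (g i)).flatten ++ v) :
    f = g ∧ u = v := by
  induction k with
  | zero => exact ⟨funext fun i => i.elim0, by simpa using h⟩
  | succ k ih =>
    simp only [List.ofFn_succ, List.flatten_cons, List.append_assoc] at h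
    obtain ⟨h0, h⟩ := hc 0 _ _ _ h
    obtain ⟨h1, h⟩ := ih (fun i => f i.succ) (fun i => g i.succ) (fun i => hc i.succ) h
    exact ⟨funext fun i => Fin.cases h0 (fun i => congrFun h1 i) i, h⟩

theorem termCode_inj {n : ℕ} (t t' : lang.Term (Empty ⊕ Fin n)) (u v : Word)
    (h : termCode t ++ u = termCode t' ++ v) : t = t' ∧ u = v := by
  induction t generalizing t' u v with
  | var x =>
    rcases x with e | i
    · exact e.elim
    cases t' with
    | var y =>
      rcases y with e | j
      · exact e.elim
      simp only [termCode, List.cons_append, List.cons.injEq, true_and] at h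
      obtain ⟨h1, h⟩ := numCode_inj h
      exact ⟨by rw [Fin.ext h1], h⟩
    | func f ts => simp [termCode, symbolCode] at h
  | func f ts ih =>
    cases t' with
    | var y =>
      rcases y with e | j
      · exact e.elim
      simp [termCode, symbolCode] at h
    | func g us =>
      simp only [termCode, List.append_assoc] at h
      obtain ⟨h1, h'⟩ := symbolCode_inj h
      cases h1
      obtain ⟨h2, h3⟩ := ofFn_flatten_inj termCode ts us (fun i b u v => ih i b u v) h'
      exact ⟨by rw [h2], h3⟩

theorem formCode_inj {n : ℕ} (f f' : lang.BoundedFormula Empty n) (u v : Word)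
    (h : formCode f ++ u = formCode f' ++ v) : f = f' ∧ u = v := by
  induction f generalizing u v with
  | falsum => cases f' <;> simp [formCode, symbolCode] at h ⊢; exact h
  | equal t s =>
    cases f' with
    | equal t' s' =>
      simp only [formCode, List.cons_append, List.cons.injEq, true_and, List.append_assoc] at h
      obtain ⟨h1, h'⟩ := termCode_inj _ _ _ _ h
      obtain ⟨h2, h3⟩ := termCode_inj _ _ _ _ h'
      exact ⟨by rw [h1, h2], h3⟩
    | _ => simp [formCode, symbolCode] at h
  | rel R ts =>
    cases f' with
    | rel R' ts' =>
      simp only [formCode, List.append_assoc] at h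
      obtain ⟨h1, h'⟩ := symbolCode_inj h
      cases h1
      obtain ⟨h2, h3⟩ := ofFn_flatten_inj termCode ts ts' (fun i b u v => termCode_inj _ b u v) h'
      exact ⟨by rw [h2], h3⟩
    | _ => simp [formCode, symbolCode] at h
  | imp f g ihf ihg =>
    cases f' with
    | imp f' g' =>
      simp only [formCode, List.cons_append, List.cons.injEq, true_and, List.append_assoc] at h
      obtain ⟨h1, h'⟩ := ihf _ _ _ h
      obtain ⟨h2, h3⟩ := ihg _ _ _ h'
      exact ⟨by rw [h1, h2], h3⟩
    | _ => simp [formCode, symbolCode] at h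
  | all f ih =>
    cases f' with
    | all f' =>
      simp only [formCode, List.cons_append, List.cons.injEq, true_and] at h
      obtain ⟨h1, h'⟩ := ih _ _ _ h
      exact ⟨by rw [h1], h'⟩
    | _ => simp [formCode, symbolCode] at h

theorem sep_notMem_numCode (n : ℕ) : Symb.sep ∉ numCode n := by simp [numCode]

theorem sep_notMem_symbolCode (s : lang.Symbols) : Symb.sep ∉ symbolCode s := by
  rcases s with ⟨n, i⟩ | ⟨n, i⟩ <;> simp [symbolCode, sep_notMem_numCode]

theorem sep_notMem_termCode {n : ℕ} (t : lang.Term (Empty ⊕ Fin n)) : Symb.sep ∉ termCode t := by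
  induction t with
  | var x =>
    rcases x with e | i
    · exact e.elim
    · simp [termCode, sep_notMem_numCode]
  | func f ts ih => simpa [termCode, sep_notMem_symbolCode, List.mem_ofFn] using ih

theorem sep_notMem_formCode {n : ℕ} (f : lang.BoundedFormula Empty n) :
    Symb.sep ∉ formCode f := by
  induction f with
  | falsum => simp [formCode]
  | equal t u => simp [formCode, sep_notMem_termCode]
  | rel R ts => simp [formCode, sep_notMem_symbolCode, sep_notMem_termCode, List.mem_ofFn]
  | imp f g ihf ihg => simp [formCode, ihf, ihg]
  | all f ih => simp [formCode, ih]

/-! ## Learning frameworks -/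

/-- A learning framework `(examples, hyps)` whose examples are formulas of some logic and whose
concept representations are knowledge bases, that is, finite sets of formulas. `Form` is the set of
formulas of the logic and `code` writes them down as words. Both sets are countable because `code`
is injective. The last field says that equivalence queries always have an answer. -/
structure LearningFramework where
  Form : Type
  entails : Finset Form → Form → Prop
  code : Form → Word
  symbols : Form → List lang.Symbols
  examples : Set Form
  hyps : Set (Finset Form)
  code_injective : Function.Injective code
  sep_notMem_code : ∀ f, Symb.sep ∉ code f
  hyps_nonempty : hyps.Nonempty
  separated : ∀ h ∈ hyps, ∀ t ∈ hyps, ¬ (∀ f, entails h f ↔ entails t f) →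
    ∃ e ∈ examples, ¬ (entails h e ↔ entails t e)

/-- The two kinds of queries: membership and equivalence. -/
inductive Query where
  | mem | eq

namespace LearningFramework

variable (F : LearningFramework)

/-- Logical equivalence of knowledge bases: they entail the same formulas. -/
def Equivalent (h t : Finset F.Form) : Prop := ∀ f, F.entails h f ↔ F.entails t f

/-- The word that lists the given formulas, each followed by the separator. -/
def listCode (l : List F.Form) : Word := l.flatMap fun f => F.code f ++ [.sep]

/-- The word `w` lists the formulas of the knowledge base `k`, in some order, without
repetitions. -/
def Codes (w : Word) (k : Finset F.Form) : Prop :=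
  ∃ l : List F.Form, (l : Multiset F.Form) = k.val ∧ w = F.listCode l

/-- The size of a knowledge base: the length of the words that code it. -/
def size (k : Finset F.Form) : ℕ := ∑ f ∈ k, ((F.code f).length + 1)

/-- `s` lists the signature of `k`, that is, the set of the non-logical symbols that occur in
`k`. -/
def ListsSignature (s : List lang.Symbols) (k : Finset F.Form) : Prop :=
  s.Nodup ∧ ∀ x, x ∈ s ↔ ∃ f ∈ k, x ∈ F.symbols f

def signatureCode (s : List lang.Symbols) : Word := s.flatMap fun x => symbolCode x ++ [.sep]

/-- `e` is a counterexample for `t` and `h`. -/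
def IsCounterexample (t h : Finset F.Form) (e : F.Form) : Prop :=
  e ∈ F.examples ∧ ((F.entails t e ∧ ¬ F.entails h e) ∨ (F.entails h e ∧ ¬ F.entails t e))

/-- `eqo` gives the answers of an equivalence oracle for the target `t`: `none` stands for "yes", and
`some e` for the counterexample `e`. -/
def IsEQOracle (t : Finset F.Form) (eqo : Finset F.Form → Option F.Form) : Prop :=
  ∀ h ∈ F.hyps, (F.Equivalent h t → eqo h = none) ∧
    (¬ F.Equivalent h t → ∃ e, eqo h = some e ∧ F.IsCounterexample t h e)

/-- Only examples may be passed to the membership oracle, and only elements of the hypothesis space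
to the equivalence oracle. -/
def ValidQuery : Query × Word → Prop
  | (.mem, w) => ∃ e ∈ F.examples, F.code e = w
  | (.eq, w) => ∃ h ∈ F.hyps, F.Codes w h

open Classical in
/-- The reply to the equivalence query `w`. -/
noncomputable def eqReply (eqo : Finset F.Form → Option F.Form) (w : Word) : Option F.Form :=
  if hw : ∃ h ∈ F.hyps, F.Codes w h then eqo hw.choose else none

open Classical in
/-- What the oracles for the target `t` write on the communication tape. -/
noncomputable def oracle (t : Finset F.Form) (eqo : Finset F.Form → Option F.Form) :
    Query → Word → Word
  | .mem, w => if ∃ e ∈ F.examples, F.code e = w ∧ F.entails t e then [.yes] else [.no]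
  | .eq, w =>
    match F.eqReply eqo w with
    | none => [.yes]
    | some e => .no :: F.code e

/-- The size of the largest counterexample among the replies to the given queries (`0` if there is
none). -/
noncomputable def largestCounterexample (eqo : Finset F.Form → Option F.Form) :
    List (Query × Word) → ℕ
  | [] => 0
  | (.mem, _) :: r => largestCounterexample eqo r
  | (.eq, w) :: r =>
    max (match F.eqReply eqo w with | none => 0 | some e => (F.code e).length)
      (largestCounterexample eqo r)

/-- `M` is a learner whose running time is bounded by `p`: for every target `t`, given the signature
of `t`, and for all answers that the oracles for `t` may give, it poses only admissible queries,
halts and outputs an element of the hypothesis space that is equivalent to `t`; and at every step of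
the computation, the time used so far is at most `p(|t|, |e|)`, where `e` is the largest
counterexample seen so far. -/
def IsPolyLearner (M : Machine Query) (p : MvPolynomial (Fin 2) ℕ) : Prop :=
  ∀ t ∈ F.hyps, ∀ s, F.ListsSignature s t → ∀ eqo, F.IsEQOracle t eqo →
    let run := M.run (F.oracle t eqo) (signatureCode s)
    ∃ N, M.Halted (run N) ∧
      (∃ h ∈ F.hyps, F.Codes (M.output (run N)) h ∧ F.Equivalent h t) ∧
      (∀ x ∈ (run N).asked, F.ValidQuery x) ∧
      ∀ n ≤ N, n ≤ MvPolynomial.eval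
        ![F.size t, F.largestCounterexample eqo (run n).asked] p

/-- Polynomial time (exact) learnability with membership and equivalence queries. -/
def PolyTimeLearnable : Prop := ∃ M p, F.IsPolyLearner M p

/-- The entailment problem of the framework (given `l` in the hypothesis space and an example `e`,
does `l` entail `e`?) is solvable in polynomial time, by a machine without oracle. -/
def EntailmentInPTime : Prop :=
  ∃ (M : Machine Empty) (p : Polynomial ℕ), ∀ l ∈ F.hyps, ∀ e ∈ F.examples, ∀ w, F.Codes w l →
    let input := w ++ F.code e
    ∃ N ≤ p.eval input.length, let c := M.run (fun q _ => q.elim) input N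
      M.Halted c ∧ (F.entails l e → M.output c = [.yes]) ∧ (¬ F.entails l e → M.output c = [.no])

/-- The class of the learning frameworks that are polynomial time learnable and whose entailment
problem is in polynomial time. -/
def InPTimeL : Prop := F.PolyTimeLearnable ∧ F.EntailmentInPTime

/-- A word codes at most one knowledge base. -/
theorem Codes.unique {w : Word} {k k' : Finset F.Form} (h : F.Codes w k) (h' : F.Codes w k') :
    k = k' := by
  obtain ⟨l, hl, rfl⟩ := h
  obtain ⟨l', hl', h⟩ := h'
  have key : ∀ a b : List F.Form, F.listCode a = F.listCode b → a = b := by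
    intro a
    induction a with
    | nil => intro b hb; cases b <;> simp [listCode] at hb ⊢
    | cons x a ih =>
      intro b hb
      cases b with
      | nil => simp [listCode] at hb
      | cons y b =>
        simp only [listCode, List.flatMap_cons, List.append_assoc, List.singleton_append] at hb
        obtain ⟨h1, h2⟩ :=
          append_mark_inj .sep (F.sep_notMem_code x) (F.sep_notMem_code y) hb
        rw [F.code_injective h1, ih b h2]
  apply Finset.val_injective
  rw [← hl, ← hl', key l l' h]

end LearningFramework

/-! ## First-order learning frameworks -/

/-- Classical first-order entailment. -/
def FOEntails (k : Finset Sentence) (f : Sentence) : Prop :=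
  FirstOrder.Language.Theory.ModelsBoundedFormula (k : Set Sentence) f

/-- A first-order learning framework: a set of first-order sentences and a set of finite sets of
first-order sentences. The last field says that equivalence queries always have an answer:
knowledge bases in `hyps` that are not equivalent differ on some example. -/
structure FOFramework where
  examples : Set Sentence
  hyps : Set (Finset Sentence)
  examples_nonempty : examples.Nonempty
  hyps_nonempty : hyps.Nonempty
  separated : ∀ h ∈ hyps, ∀ t ∈ hyps, ¬ (∀ f, FOEntails h f ↔ FOEntails t f) →
    ∃ e ∈ examples, ¬ (FOEntails h e ↔ FOEntails t e)

def FOFramework.toLearningFramework (F : FOFramework) : LearningFramework where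
  Form := Sentence
  entails := FOEntails
  code f := formCode f
  symbols f := formSymbols f
  examples := F.examples
  hyps := F.hyps
  code_injective f g h := (formCode_inj f g [] [] (by simpa using h)).1
  sep_notMem_code f := sep_notMem_formCode f
  hyps_nonempty := F.hyps_nonempty
  separated := F.separated

/-! ## Possibilistic logic -/

/-- `α` has at most `p` decimals. -/
def HasPrec (α : ℝ) (p : ℕ) : Prop := ∃ m : ℕ, α * 10 ^ p = m

/-- Valuations: the real numbers in `(0, 1]` with finite (decimal) precision. -/
def Valuation := {α : ℝ // 0 < α ∧ α ≤ 1 ∧ ∃ p, HasPrec α p}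

open Classical in
/-- The precision of a valuation. -/
noncomputable def Valuation.prec (α : Valuation) : ℕ := Nat.find α.2.2.2

/-- Decimal notation: the integral part of `α`, followed by the decimals of `α` up to its
precision. -/
noncomputable def Valuation.code (α : Valuation) : Word :=
  List.ofFn fun i : Fin (α.prec + 1) => Symb.dig (Fin.ofNat 10 ⌊α.1 * 10 ^ (i : ℕ)⌋₊)

theorem Valuation.code_injective : Function.Injective Valuation.code := by
  classical
  intro α β h
  have hlen : α.prec = β.prec := by
    have := congrArg List.length h
    simpa [Valuation.code] using this
  have hdig : ∀ i ≤ α.prec, ⌊α.1 * 10 ^ i⌋₊ % 10 = ⌊β.1 * 10 ^ i⌋₊ % 10 := by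
    intro i hi
    have h1 := congrArg (fun l => l[i]?) h
    simp only [Valuation.code, List.getElem?_ofFn] at h1
    rw [dif_pos (by omega), dif_pos (by omega)] at h1
    simpa [Fin.ext_iff] using h1
  have hfl : ∀ (x : ℝ) (i : ℕ), 0 ≤ x → ⌊x * 10 ^ (i + 1)⌋₊ / 10 = ⌊x * 10 ^ i⌋₊ := by
    intro x i hx
    rw [← Nat.floor_div_natCast]
    congr 1
    push_cast
    rw [pow_succ]
    field_simp
  have hsmall : ∀ γ : Valuation, ⌊γ.1 * 10 ^ 0⌋₊ < 10 := by
    intro γ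
    rw [Nat.floor_lt (by have := γ.2.1; simp; linarith)]
    have := γ.2.2.1
    norm_num
    linarith
  have hall : ∀ i ≤ α.prec, ⌊α.1 * 10 ^ i⌋₊ = ⌊β.1 * 10 ^ i⌋₊ := by
    intro i
    induction i with
    | zero =>
      intro hi
      have := hdig 0 hi
      rwa [Nat.mod_eq_of_lt (hsmall α), Nat.mod_eq_of_lt (hsmall β)] at this
    | succ i ih =>
      intro hi
      have h1 := hdig (i + 1) hi
      have h2 := ih (by omega)
      rw [← hfl _ _ α.2.1.le, ← hfl _ _ β.2.1.le] at h2
      omega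
  have h1 := hall α.prec le_rfl
  obtain ⟨a, ha⟩ : HasPrec α.1 α.prec := Nat.find_spec α.2.2.2
  obtain ⟨b, hb⟩ : HasPrec β.1 α.prec := hlen ▸ Nat.find_spec β.2.2.2
  rw [ha, hb, Nat.floor_natCast, Nat.floor_natCast] at h1
  apply Subtype.ext
  have h10 : (10 : ℝ) ^ α.prec ≠ 0 := by positivity
  exact mul_right_cancel₀ h10 (by rw [ha, hb, h1])

/-- Possibilistic formulas `(φ, α)`. -/
abbrev PossFormula := Sentence × Valuation

/-- Interpretations: first-order structures with a non-empty domain. -/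
abbrev Interp := FirstOrder.Language.Theory.ModelType.{0, 0, 0} (∅ : lang.Theory)

/-- The possibility measure induced by `π`. -/
noncomputable def possibility (π : Interp → ℝ) (f : Sentence) : ℝ :=
  sSup {x | ∃ I : Interp, FirstOrder.Language.Sentence.Realize I f ∧ π I = x}

/-- The necessity measure induced by `π`. -/
noncomputable def necessity (π : Interp → ℝ) (f : Sentence) : ℝ := 1 - possibility π f.not

/-- Possibilistic entailment: every possibility distribution that satisfies `k` satisfies `x`. -/
def PossEntails (k : Finset PossFormula) (x : PossFormula) : Prop :=
  ∀ π : Interp → ℝ, (∀ I, 0 ≤ π I ∧ π I ≤ 1) →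
    (∀ y ∈ k, y.2.1 ≤ necessity π y.1) → x.2.1 ≤ necessity π x.1

/-- `k` is obtained by adding a valuation to every formula of `l`. -/
def IsPossExt (k : Finset PossFormula) (l : Finset Sentence) : Prop :=
  ∃ v : Sentence → Valuation, (k : Set PossFormula) = (fun f => (f, v f)) '' (l : Set Sentence)

namespace FOFramework

variable (F : FOFramework)

/-- The framework is formulated in the language (set of sentences) `L`. -/
def InLanguage (L : Set Sentence) : Prop :=
  F.examples ⊆ L ∧ ∀ l ∈ F.hyps, ∀ f ∈ l, f ∈ L

/-- The possibilistic extensions of the elements of the hypothesis space. -/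
def possHyps : Set (Finset PossFormula) := {k | ∃ l ∈ F.hyps, IsPossExt k l}

/-- The possibilistic formulas over `L` that are entailed by some element of `F.possHyps`. -/
def possExamples (L : Set Sentence) : Set PossFormula :=
  {x | x.1 ∈ L ∧ ∃ k ∈ F.possHyps, PossEntails k x}

theorem possHyps_nonempty : F.possHyps.Nonempty := by
  classical
  obtain ⟨l, hl⟩ := F.hyps_nonempty
  let one : Valuation := ⟨1, by norm_num, le_rfl, 0, 1, by norm_num⟩
  exact ⟨l.image fun f => (f, one), l, hl, fun _ => one, by simp⟩

theorem PossEntails.of_mem {k : Finset PossFormula} {x : PossFormula} (h : x ∈ k) :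
    PossEntails k x := fun _ _ hk => hk x h

theorem mem_possExamples_of_mem {L : Set Sentence} (hL : F.InLanguage L) {k : Finset PossFormula}
    (hk : k ∈ F.possHyps) {x : PossFormula} (hx : x ∈ k) : x ∈ F.possExamples L := by
  refine ⟨?_, k, hk, PossEntails.of_mem hx⟩
  obtain ⟨l, hl, v, hv⟩ := hk
  have : x ∈ (k : Set PossFormula) := hx
  rw [hv] at this
  obtain ⟨f, hf, rfl⟩ := this
  exact hL.2 l hl f hf

/-- The possibilistic extension of a first-order learning framework formulated in `L`. -/
noncomputable def possExt (L : Set Sentence) (hL : F.InLanguage L) : LearningFramework where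
  Form := PossFormula
  entails := PossEntails
  code x := formCode x.1 ++ x.2.code
  symbols x := formSymbols x.1
  examples := F.possExamples L
  hyps := F.possHyps
  code_injective x y h := by
    obtain ⟨h1, h2⟩ := formCode_inj x.1 y.1 _ _ h
    exact Prod.ext h1 (Valuation.code_injective h2)
  sep_notMem_code x := by
    simp [Valuation.code, sep_notMem_formCode, List.mem_ofFn]
  hyps_nonempty := F.possHyps_nonempty
  separated h hh t ht hne := by
    by_contra hcon
    push Not at hcon
    apply hne
    have key : ∀ a ∈ F.possHyps, ∀ b ∈ F.possHyps,
        (∀ e ∈ F.possExamples L, PossEntails a e ↔ PossEntails b e) →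
        ∀ x, PossEntails a x → PossEntails b x := by
      intro a ha b hb hab x hx π hπ hsat
      refine hx π hπ fun y hy => ?_
      exact (hab y (F.mem_possExamples_of_mem hL ha hy)).1 (PossEntails.of_mem hy) π hπ hsat
    exact fun x => ⟨key h hh t ht hcon x, key t ht h hh (fun e he => (hcon e he).symm) x⟩

end FOFramework

end PossLearn

open PossLearn

namespace PossLearn

/-! ## Runs of machines -/

namespace Machine

variable {Q : Type} (M : Machine Q) (O : Q → Word → Word) (input : Word)

/-! The framework consists of the knowledge bases `{base}` and `{base, hidden x}`, with `x` a bit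
string of any length `n` and `hidden x` the sentence `base ∨ (marker n ∧ clause x)`. As `base`
implies `hidden x`, all of them are classically equivalent (`foEntails_hiddenHyps_iff`), so a
learner may always output `{base}` without asking anything, and since every example follows from
`base`, entailment is trivial too.

Valuations undo this redundancy. In `target x`, where `base` has valuation 1/2 and `hidden x` has
valuation 1, only `hidden x` counts above the level 1/2 (`possEntails_iff`), so the `2 ^ n` targets
are pairwise inequivalent, although they have the same signature and size polynomial in `n`.

An adversary answers membership queries as if the target were `common n`, where `hidden x` is
weakened to `base ∨ marker n`. A formula not entailed by `common n` is entailed by at most one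
target, because an interpretation has only one bit string (`eq_of_possEntails_target`). Equivalence
queries get `commonAnswer`, a short formula chosen from the hypothesis alone, which is a
counterexample for all targets but at most one (`not_isCounterexample_commonAnswer`). Thus each
query rules out at most one target (`eq_of_oracle_ne`), and a learner with polynomially many steps
would have to give the same output for two inequivalent targets (`IsPolyLearner.exists_equivalent`).
-/

theorem run_succ (n : ℕ) : M.run O input (n + 1) = M.step O (M.run O input n) :=
  Function.iterate_succ_apply' _ _ _

theorem asked_step (c : Config M) :
    (M.step O c).asked = c.asked ∨
      ∃ q s, M.instr c = .query q s ∧ (M.step O c).asked = (q, (c.tapes 1).word) :: c.asked := by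
  unfold step
  split
  · exact .inl rfl
  · exact .inr ⟨_, _, ‹_›, rfl⟩
  · exact .inl rfl

theorem asked_subset_step (c : Config M) : c.asked ⊆ (M.step O c).asked := by
  rcases M.asked_step O c with h | ⟨q, s, -, h⟩ <;> rw [h]
  · exact List.Subset.refl _
  · exact List.subset_cons_self _ _

theorem length_asked_run_le (n : ℕ) : (M.run O input n).asked.length ≤ n := by
  induction n with
  | zero => simp [run, init]
  | succ n ih =>
    rw [run_succ]
    rcases M.asked_step O (M.run O input n) with h | ⟨q, s, -, h⟩ <;>
      simp only [h, List.length_cons] <;> omega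

theorem asked_run_subset {m n : ℕ} (h : m ≤ n) :
    (M.run O input m).asked ⊆ (M.run O input n).asked := by
  induction n, h using Nat.le_induction with
  | base => exact List.Subset.refl _
  | succ n _ ih => exact List.Subset.trans ih (by rw [run_succ]; exact M.asked_subset_step O _)

/-- Two oracles that agree on the queries posed in a run give the same run. -/
theorem run_congr {O O' : Q → Word → Word} {n : ℕ}
    (h : ∀ x ∈ (M.run O input n).asked, O' x.1 x.2 = O x.1 x.2) :
    M.run O' input n = M.run O input n := by
  induction n with
  | zero => rfl
  | succ n ih =>
    rw [run_succ, ih fun x hx => h x (M.asked_run_subset O input n.le_succ hx), run_succ]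
    rcases hi : M.instr (M.run O input n) with _ | ⟨q, s⟩ | _
    · simp [step, hi]
    -- The query posed in this step heads the record after `n + 1` steps, so the two oracles agree
    -- on it.
    · have := h (q, ((M.run O input n).tapes 1).word) (by rw [run_succ]; simp [step, hi])
      simp only [step, hi, this]
    · simp [step, hi]

variable {M} in
theorem Halted.step_eq {c : Config M} (h : M.Halted c) : M.step O c = c := by
  unfold Halted at h
  simp [step, h]

variable {M O input} in
theorem Halted.run_eq {m n : ℕ} (h : M.Halted (M.run O input m)) (hmn : m ≤ n) :
    M.run O input n = M.run O input m := by
  induction n, hmn using Nat.le_induction with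
  | base => rfl
  | succ n _ ih => rw [run_succ, ih, h.step_eq]

/-! ### Machines with constant output -/

/-- The machine that writes the word `w` on the tape `1`, from its last symbol to its first one,
moves the head back to the first symbol and halts. -/
def const (Q : Type) (w : Word) : Machine Q where
  extra := 0
  State := Option (Fin (w.length + 1))
  start := some (Fin.last _)
  next
    | none, _ => .halt
    | some s, _ =>
      if h : s = 0 then .act none fun _ => (none, .right)
      else .act (some (s.pred h).castSucc) fun _ => (some (w.get (s.pred h)), .left)

/-- The loop invariant: `k` symbols remain to be written and the others lie to the right of the
head. Only the tail of `right` is described, since the list is empty at the start and later begins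
with the blank under the head. -/
theorem const_run (w : Word) (n k : ℕ) (hn : n + k = w.length) :
    ((const Q w).run O input n).state = some (⟨k, by omega⟩ : Fin (w.length + 1)) ∧
    (((const Q w).run O input n).tapes 1).left = [] ∧
    (((const Q w).run O input n).tapes 1).right.tail = (w.drop k).map some ∧
    ((const Q w).run O input n).asked = [] := by
  induction n generalizing k with
  | zero =>
    obtain rfl : k = w.length := by omega
    exact ⟨rfl, rfl, by simp [run, init, Tape.ofWord], rfl⟩
  | succ n ih =>
    obtain ⟨h1, h2, h3, h4⟩ := ih (k + 1) (by omega)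
    rw [run_succ]
    generalize (const Q w).run O input n = c at h1 h2 h3 h4
    have hi : (const Q w).instr c = .act (some (⟨k, by omega⟩ : Fin (w.length + 1)))
        fun _ => (some (w[k]'(by omega)), .left) := by
      unfold instr
      rw [h1]
      rfl
    unfold step
    rw [hi]
    refine ⟨rfl, ?_, ?_, h4⟩
    · simp [Tape.write, Tape.move, h2]
    · simp only [Tape.write, Tape.move, List.tail_cons, h3,
        List.drop_eq_getElem_cons (by omega : k < w.length), List.map_cons]

theorem word_mk_map_some (l : List (Option Symb)) (w : Word) : Tape.word ⟨l, w.map some⟩ = w := by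
  have h : ∀ w : Word, (w.map some).takeWhile Option.isSome = w.map some := by
    intro w
    induction w <;> simp_all
  simp only [Tape.word, h]
  induction w <;> simp_all [List.reduceOption]

theorem const_halted (w : Word) :
    (const Q w).Halted ((const Q w).run O input (w.length + 1)) ∧
    (const Q w).output ((const Q w).run O input (w.length + 1)) = w ∧
    ((const Q w).run O input (w.length + 1)).asked = [] := by
  obtain ⟨h1, h2, h3, h4⟩ := const_run O input w w.length 0 rfl
  rw [run_succ]
  generalize (const Q w).run O input w.length = c at h1 h2 h3 h4
  have hi : (const Q w).instr c = .act none fun _ => (none, .right) := by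
    unfold instr
    rw [h1]
    rfl
  unfold step
  rw [hi]
  refine ⟨rfl, ?_, h4⟩
  simp only [output, Tape.write, Tape.move, List.tail_cons, h3, List.drop_zero]
  exact word_mk_map_some _ w

end Machine

/-! ## An adversary argument for non-learnability -/

/-- If every element of `l` excludes at most one candidate, then two candidates survive. -/
theorem exists_ne_of_length_lt_card {Z X : Type} [Fintype X] (l : List Z) (B : Z → X → Prop)
    (hB : ∀ z x y, B z x → B z y → x = y) (h : l.length + 1 < Fintype.card X) :
    ∃ x y, x ≠ y ∧ (∀ z ∈ l, ¬ B z x) ∧ ∀ z ∈ l, ¬ B z y := by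
  classical
  set bad : Finset X := l.toFinset.biUnion fun z => Finset.univ.filter (B z) with hbad
  have h1 : bad.card ≤ l.length := by
    refine (Finset.card_biUnion_le_card_mul _ _ 1 fun z _ => ?_).trans ?_
    · exact Finset.card_le_one.2 fun x hx y hy => hB z x y (by simpa using hx) (by simpa using hy)
    · simpa using List.toFinset_card_le l
  have h2 : 1 < badᶜ.card := by
    rw [Finset.card_compl]
    omega
  obtain ⟨x, hx, y, hy, hxy⟩ := Finset.one_lt_card.1 h2
  refine ⟨x, y, hxy, ?_, ?_⟩ <;> simp_all

theorem _root_.MvPolynomial.eval_nat_mono {σ : Type} (p : MvPolynomial σ ℕ) {a b : σ → ℕ}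
    (h : ∀ i, a i ≤ b i) : MvPolynomial.eval a p ≤ MvPolynomial.eval b p := by
  simp only [MvPolynomial.eval_eq]
  gcongr
  exact h _

namespace LearningFramework

variable {F : LearningFramework}

/-- A reply carrying a counterexample has the extra symbol `.no`, whence `B + 1`. The hypothesis
speaks of replies so that it can be transferred from an oracle that merely agrees with this one on
the queries posed. -/
theorem largestCounterexample_le {t : Finset F.Form} {eqo : Finset F.Form → Option F.Form} {B : ℕ}
    (l : List (Query × Word))
    (h : ∀ x ∈ l, x.1 = .eq → (F.oracle t eqo .eq x.2).length ≤ B + 1) :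
    F.largestCounterexample eqo l ≤ B := by
  induction l with
  | nil => simp [largestCounterexample]
  | cons x l ih =>
    have ih := ih fun x hx => h x (List.mem_cons_of_mem _ hx)
    obtain ⟨_ | _, w⟩ := x
    · exact ih
    · have := h (.eq, w) (by simp) rfl
      simp only [oracle] at this
      simp only [largestCounterexample]
      refine max_le ?_ ih
      cases h : F.eqReply eqo w <;> simp_all

/-- An adversary that answers like `O`. If every query tells at most one of the targets `t x` from
`O`, and there are more targets than the learner has time to query, then the learner identifies
two targets. -/
theorem IsPolyLearner.exists_equivalent {M : Machine Query} {p : MvPolynomial (Fin 2) ℕ}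
    (hM : F.IsPolyLearner M p) {X : Type} [Fintype X] {t : X → Finset F.Form}
    (ht : ∀ x, t x ∈ F.hyps) {s : List lang.Symbols} (hs : ∀ x, F.ListsSignature s (t x))
    {eqo : X → Finset F.Form → Option F.Form} (heqo : ∀ x, F.IsEQOracle (t x) (eqo x))
    {O : Query → Word → Word} {S B : ℕ} (hS : ∀ x, F.size (t x) ≤ S)
    (hB : ∀ w, (O .eq w).length ≤ B + 1)
    (hO : ∀ q w x y, F.oracle (t x) (eqo x) q w ≠ O q w → F.oracle (t y) (eqo y) q w ≠ O q w →
      x = y)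
    (hcard : MvPolynomial.eval ![S, B] p + 2 < Fintype.card X) :
    ∃ x y, x ≠ y ∧ F.Equivalent (t x) (t y) := by
  set T := MvPolynomial.eval ![S, B] p with hT
  set input := signatureCode s
  -- A target not told apart from `O` within `T + 1` steps has the same run as `O` so far. That run
  -- must stop by time `T`, as being still active at time `T + 1` would break the time bound.
  have key : ∀ x, (∀ z ∈ (M.run O input (T + 1)).asked,
      ¬ F.oracle (t x) (eqo x) z.1 z.2 ≠ O z.1 z.2) →
      ∃ h, F.Codes (M.output (M.run O input T)) h ∧ F.Equivalent h (t x) := by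
    intro x hx
    have hrun : ∀ n ≤ T + 1, M.run (F.oracle (t x) (eqo x)) input n = M.run O input n :=
      fun n hn => M.run_congr input fun z hz =>
        not_not.1 (hx z (M.asked_run_subset O input hn hz))
    obtain ⟨N, hhalt, ⟨h, -, hcode, heq⟩, -, htime⟩ := hM (t x) (ht x) s (hs x) (eqo x) (heqo x)
    have hbound : ∀ n ≤ N, n ≤ T + 1 → n ≤ T := by
      intro n hn hnT
      refine (htime n hn).trans (p.eval_nat_mono fun i => ?_)
      fin_cases i
      · exact hS x
      · refine largestCounterexample_le (t := t x) _ fun z hz hz1 => ?_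
        rw [hrun n hnT] at hz
        obtain ⟨q, w⟩ := z
        obtain rfl : q = .eq := hz1
        rw [not_not.1 (hx _ (M.asked_run_subset O input hnT hz))]
        exact hB w
    have hN : N ≤ T := by
      by_contra hlt
      have := hbound (T + 1) (by omega) le_rfl
      omega
    refine ⟨h, ?_, heq⟩
    rwa [← hrun T (by omega), hhalt.run_eq hN]
  -- At most `T + 1` queries are posed in `T + 1` steps, and each excludes at most one candidate, so
  -- more than `T + 2` candidates leave two. Both then have the output of the run against `O`.
  obtain ⟨x, y, hxy, hx, hy⟩ := exists_ne_of_length_lt_card (M.run O input (T + 1)).asked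
    (fun z x => F.oracle (t x) (eqo x) z.1 z.2 ≠ O z.1 z.2) (fun z x y => hO z.1 z.2 x y)
    (by have := M.length_asked_run_le O input (T + 1); omega)
  obtain ⟨h, hh, hhx⟩ := key x hx
  obtain ⟨h', hh', hhy⟩ := key y hy
  obtain rfl := Codes.unique F hh hh'
  exact ⟨x, y, hxy, fun f => (hhx f).symm.trans (hhy f)⟩

/-! ### How oracle replies depend on the target and on the chosen answers -/

theorem oracle_mem_congr {t t' : Finset F.Form}
    {eqo eqo' : Finset F.Form → Option F.Form} {w : Word}
    (h : ∀ e, F.code e = w → (F.entails t e ↔ F.entails t' e)) :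
    F.oracle t eqo .mem w = F.oracle t' eqo' .mem w := by
  have : (∃ e ∈ F.examples, F.code e = w ∧ F.entails t e) ↔
      ∃ e ∈ F.examples, F.code e = w ∧ F.entails t' e :=
    exists_congr fun e => and_congr_right fun _ => and_congr_right (h e)
  classical
  exact if_congr this rfl rfl

/-- Replies to equivalence queries depend only on the answer function, so `t` and `t'` are
arbitrary. This allows a comparison with `common n`, which is only a device of the adversary. -/
theorem oracle_eq_congr {t t' : Finset F.Form}
    {eqo eqo' : Finset F.Form → Option F.Form} {w : Word}
    (h : ∀ k ∈ F.hyps, F.Codes w k → eqo k = eqo' k) :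
    F.oracle t eqo .eq w = F.oracle t' eqo' .eq w := by
  have : F.eqReply eqo w = F.eqReply eqo' w := by
    unfold eqReply
    split_ifs with hw
    · exact h _ hw.choose_spec.1 hw.choose_spec.2
    · rfl
  simp only [oracle, this]

theorem length_oracle_eq_le {t : Finset F.Form} {eqo : Finset F.Form → Option F.Form} {B : ℕ}
    (h : ∀ k e, eqo k = some e → (F.code e).length ≤ B) (w : Word) :
    (F.oracle t eqo .eq w).length ≤ B + 1 := by
  have key : ∀ e, F.eqReply eqo w = some e → (F.code e).length ≤ B := by
    intro e he
    unfold eqReply at he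
    split_ifs at he
    exact h _ e he
  simp only [oracle]
  split
  · simp
  · simpa using key _ ‹_›

variable (F) in
open Classical in
/-- The equivalence oracle for `t` that answers the query `h` with `a h` if that is a
counterexample. -/
noncomputable def preferredAnswer (t : Finset F.Form) (a : Finset F.Form → F.Form)
    (h : Finset F.Form) : Option F.Form :=
  if F.IsCounterexample t h (a h) then some (a h)
  else if he : ∃ e, F.IsCounterexample t h e then some he.choose else none

theorem preferredAnswer_of_isCounterexample {t h : Finset F.Form} {a : Finset F.Form → F.Form}
    (hc : F.IsCounterexample t h (a h)) : F.preferredAnswer t a h = some (a h) :=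
  if_pos hc

theorem isEQOracle_preferredAnswer {t : Finset F.Form} (ht : t ∈ F.hyps)
    (a : Finset F.Form → F.Form) : F.IsEQOracle t (F.preferredAnswer t a) := by
  intro h hh
  constructor
  · intro heq
    have hno : ∀ e, ¬ F.IsCounterexample t h e := by
      rintro e ⟨-, ⟨h1, h2⟩ | ⟨h1, h2⟩⟩
      · exact h2 ((heq e).2 h1)
      · exact h2 ((heq e).1 h1)
    rw [preferredAnswer, if_neg (hno _), dif_neg (not_exists.2 hno)]
  · intro hne
    obtain ⟨e, he, hde⟩ := F.separated h hh t ht hne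
    have hex : ∃ e, F.IsCounterexample t h e := ⟨e, he, by tauto⟩
    unfold preferredAnswer
    split_ifs with h1
    · exact ⟨_, rfl, h1⟩
    · exact ⟨_, rfl, hex.choose_spec⟩

end LearningFramework

theorem _root_.Polynomial.exists_eval_lt_two_pow (p : Polynomial ℕ) :
    ∃ n : ℕ, p.eval n < 2 ^ n := by
  have h : (fun n : ℕ => ((p.eval n : ℕ) : ℝ)) =o[Filter.atTop] fun n : ℕ => (2 : ℝ) ^ n := by
    induction p using Polynomial.induction_on' with
    | add p q hp hq => simpa using hp.add hq
    | monomial k a =>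
      simp only [Polynomial.eval_monomial, Nat.cast_mul, Nat.cast_pow]
      exact (isLittleO_pow_const_const_pow_of_one_lt k one_lt_two).const_mul_left _
  -- Any constant below 1 turns the asymptotic bound into a strict inequality.
  have h' := h.def (c := 1 / 2) (by norm_num)
  obtain ⟨n, hn⟩ := h'.exists
  refine ⟨n, ?_⟩
  simp only [Real.norm_natCast, norm_pow, Real.norm_ofNat] at hn
  have : (0 : ℝ) < 2 ^ n := by positivity
  have : ((p.eval n : ℕ) : ℝ) < 2 ^ n := by linarith
  exact_mod_cast this

open FirstOrder.Language

/-! ## Level cuts of possibilistic knowledge bases -/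

def Holds (I : Interp) (f : Sentence) : Prop := Sentence.Realize I f

theorem foEntails_iff {k : Finset Sentence} {f : Sentence} :
    FOEntails k f ↔ ∀ I : Interp, (∀ g ∈ k, Holds I g) → Holds I f := by
  refine Theory.models_sentence_iff.trans ⟨fun h I hI => ?_, fun h M => ?_⟩
  · have : Theory.Model I.Carrier (k : lang.Theory) := ⟨fun g hg => hI g hg⟩
    exact h (Theory.ModelType.of (k : lang.Theory) I.Carrier)
  · exact h (Theory.ModelType.of (∅ : lang.Theory) M.Carrier)
      fun g hg => M.is_model.realize_of_mem g hg

/-- A supremum is bounded by a number when all its elements are. If `f` is valid the supremum is `0`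
by convention, and `c ≤ 1` is what covers this case. -/
theorem le_necessity_iff {π : Interp → ℝ} (hπ : ∀ I, 0 ≤ π I ∧ π I ≤ 1) {f : Sentence} {c : ℝ}
    (hc : c ≤ 1) : c ≤ necessity π f ↔ ∀ I, ¬ Holds I f → π I ≤ 1 - c := by
  have hle : necessity π f = 1 - sSup {x | ∃ I : Interp, ¬ Holds I f ∧ π I = x} := rfl
  rw [hle, le_sub_comm]
  constructor
  · intro h I hI
    have hb : BddAbove {x | ∃ I : Interp, ¬ Holds I f ∧ π I = x} := by
      refine ⟨1, ?_⟩
      rintro _ ⟨J, -, rfl⟩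
      exact (hπ J).2
    exact (le_csSup hb ⟨I, hI, rfl⟩).trans h
  · intro h
    refine Real.sSup_le ?_ (by linarith)
    rintro _ ⟨J, hJ, rfl⟩
    exact h J hJ

/-- A possibilistic formula is entailed if and only if its sentence is entailed by the sentences
with at least the same valuation. -/
theorem possEntails_iff {k : Finset PossFormula} {f : Sentence} {c : Valuation} :
    PossEntails k (f, c) ↔ ∀ I, ¬ Holds I f → ∃ y ∈ k, c.1 ≤ y.2.1 ∧ ¬ Holds I y.1 := by
  classical
  constructor
  · intro h I hI
    by_contra! hcon
    -- `m` is the largest valuation of a member of `k` that is false in `I`, or `0` if there is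
    -- none.
    obtain ⟨m, hm0, hmc, hm⟩ : ∃ m : ℝ, 0 ≤ m ∧ m < c.1 ∧ ∀ y ∈ k, ¬ Holds I y.1 → y.2.1 ≤ m := by
      let u : Finset ℝ := insert 0 ((k.filter fun y => ¬ Holds I y.1).image fun y => y.2.1)
      refine ⟨u.max' (Finset.insert_nonempty _ _), u.le_max' _ (by simp [u]), ?_, fun y hy hyI =>
        u.le_max' _ ?_⟩
      · refine (Finset.max'_lt_iff _ _).2 fun a ha => ?_
        rcases Finset.mem_insert.1 ha with rfl | ha
        · exact c.2.1
        · obtain ⟨y, hy, rfl⟩ := Finset.mem_image.1 ha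
          obtain ⟨hy, hyI⟩ := Finset.mem_filter.1 hy
          exact lt_of_not_ge fun hle => hyI (hcon y hy hle)
      · exact Finset.mem_insert_of_mem
          (Finset.mem_image.2 ⟨y, Finset.mem_filter.2 ⟨hy, hyI⟩, rfl⟩)
    have hc1 := c.2.2.1
    -- Concentrated on `I`, this distribution satisfies `k`, but it gives `f` necessity at most `m`,
    -- which is less than `c`.
    let π : Interp → ℝ := fun J => if J = I then 1 - m else 0
    have hπ : ∀ J, 0 ≤ π J ∧ π J ≤ 1 := by
      intro J
      simp only [π]
      split <;> constructor <;> linarith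
    have := (le_necessity_iff hπ hc1).1 (h π hπ fun y hy => ?_) I hI
    · simp only [π, if_pos] at this
      linarith
    · refine (le_necessity_iff hπ y.2.2.2.1).2 fun J hJ => ?_
      simp only [π]
      split
      · subst J
        linarith [hm y hy hJ]
      · linarith [y.2.2.2.1]
  · intro h π hπ hk
    refine (le_necessity_iff hπ c.2.2.1).2 fun I hI => ?_
    obtain ⟨y, hy, hc, hyI⟩ := h I hI
    have := (le_necessity_iff hπ y.2.2.2.1).1 (hk y hy) I hyI
    linarith

/-! ## Propositional sentences -/

/-- Propositional variables. -/
def letter (i : ℕ) : Sentence := .rel (l := 0) (show lang.Relations 0 from i) Fin.elim0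

/-- A one-element structure with a given assignment to the propositional variables. -/
abbrev propStructure (v : ℕ → Prop) : lang.Structure Unit where
  funMap _ _ := ()
  RelMap r _ := v r

def propInterp (v : ℕ → Prop) : Interp :=
  letI := propStructure v
  Theory.ModelType.of (∅ : lang.Theory) Unit

@[simp] theorem holds_letter (v : ℕ → Prop) (i : ℕ) :
    Holds (propInterp v) (letter i) ↔ v i := Iff.rfl

@[simp] theorem holds_imp (I : Interp) (f g : Sentence) :
    Holds I (BoundedFormula.imp f g) ↔ (Holds I f → Holds I g) := Iff.rfl

@[simp] theorem holds_falsum (I : Interp) : Holds I BoundedFormula.falsum ↔ False := Iff.rfl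

/-- Letter `0` is the base, odd letters are the bits and positive even letters the markers, so all
can be assigned independently. -/
def base : Sentence := letter 0

def marker (n : ℕ) : Sentence := letter (2 * n + 2)

/-- The literal which says that the `i`-th bit is `b`. -/
def lit (i : ℕ) : Bool → Sentence
  | true => letter (2 * i + 1)
  | false => (letter (2 * i + 1)).imp .falsum

/-- The bits are not those of `x`. -/
def clause {n : ℕ} (x : Fin n → Bool) : Sentence :=
  (List.ofFn fun i : Fin n => lit i (x i)).foldr BoundedFormula.imp .falsum

/-- `base ∨ marker n` -/
def weak (n : ℕ) : Sentence := (base.imp .falsum).imp (marker n)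

/-- `base ∨ (marker n ∧ clause x)` -/
def hidden {n : ℕ} (x : Fin n → Bool) : Sentence :=
  (base.imp .falsum).imp (((marker n).imp ((clause x).imp .falsum)).imp .falsum)

/-- The bits of an interpretation are those of `x`. -/
def HasBits (I : Interp) {n : ℕ} (x : Fin n → Bool) : Prop :=
  ∀ i : Fin n, Holds I (letter (2 * i + 1)) ↔ x i = true

/-- The root of the adversary argument: one interpretation can refute `clause x` for only one `x` of
a given length. -/
theorem HasBits.unique {I : Interp} {n : ℕ} {x y : Fin n → Bool} (hx : HasBits I x)
    (hy : HasBits I y) : x = y :=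
  funext fun i => Bool.eq_iff_iff.2 ((hx i).symm.trans (hy i))

theorem holds_clause (I : Interp) {n : ℕ} (x : Fin n → Bool) :
    Holds I (clause x) ↔ ¬ HasBits I x := by
  -- A chain of implications ending in falsum is the negation of the conjunction of its premises.
  have h : ∀ l : List Sentence, Holds I (l.foldr BoundedFormula.imp .falsum) ↔
      ¬ ∀ g ∈ l, Holds I g := by
    intro l
    induction l with
    | nil => simp
    | cons g l ih => simp only [List.foldr_cons, holds_imp, ih, List.forall_mem_cons]; tauto
  rw [clause, h, not_iff_not, List.forall_mem_ofFn_iff]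
  refine forall_congr' fun i => ?_
  cases x i <;> simp [lit]

theorem holds_weak (I : Interp) (n : ℕ) :
    Holds I (weak n) ↔ Holds I base ∨ Holds I (marker n) := by
  simp only [weak, holds_imp, holds_falsum]; tauto

theorem holds_hidden (I : Interp) {n : ℕ} (x : Fin n → Bool) :
    Holds I (hidden x) ↔ Holds I base ∨ Holds I (marker n) ∧ ¬ HasBits I x := by
  simp only [hidden, holds_imp, holds_falsum, holds_clause]; tauto

/-- A possibilistic extension gives each sentence a single valuation, so the two members of a target
must have different sentences. -/
theorem hidden_ne_base {n : ℕ} (x : Fin n → Bool) : hidden x ≠ base := by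
  simp [hidden, base, letter]

/-- An interpretation in which `base` is false and the markers and the bits are as given. -/
theorem exists_interp (s b : ℕ → Prop) :
    ∃ I, ¬ Holds I base ∧ (∀ m, Holds I (marker m) ↔ s m) ∧
      ∀ i, Holds I (letter (2 * i + 1)) ↔ b i := by
  refine ⟨propInterp fun j => (∃ m, j = 2 * m + 2 ∧ s m) ∨ ∃ i, j = 2 * i + 1 ∧ b i, ?_,
    fun m => ?_, fun i => ?_⟩
  · simp [base]
  · simp only [marker, holds_letter]
    constructor
    · rintro (⟨k, h, hk⟩ | ⟨i, h, -⟩)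
      · obtain rfl : m = k := by omega
        exact hk
      · omega
    · exact fun h => .inl ⟨m, rfl, h⟩
  · simp only [holds_letter]
    constructor
    · rintro (⟨k, h, hk⟩ | ⟨j, h, hj⟩)
      · omega
      · obtain rfl : i = j := by omega
        exact hj
    · exact fun h => .inr ⟨i, rfl, h⟩

theorem exists_interp_hasBits {n : ℕ} (x : Fin n → Bool) :
    ∃ I, ¬ Holds I base ∧ (∀ m, Holds I (marker m)) ∧ HasBits I x := by
  obtain ⟨I, h1, h2, h3⟩ := exists_interp (fun _ => True) fun i => ∃ h : i < n, x ⟨i, h⟩ = true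
  exact ⟨I, h1, fun m => (h2 m).2 trivial, fun i => by simp [h3]⟩

/-! ### Codes and symbols -/

/-- This bound and the following ones are crude: only polynomial growth in `n` matters. -/
theorem length_numCode_le (n : ℕ) : (numCode n).length ≤ n + 2 := by
  have : (Nat.digits 10 n).length ≤ n + 1 := by
    rcases Nat.eq_zero_or_pos n with rfl | h
    · simp
    · rw [Nat.length_digits 10 n (by norm_num) h.ne']
      have := Nat.log_le_self 10 n
      omega
  simp [numCode]
  omega

theorem length_letter_le (i : ℕ) : (formCode (letter i)).length ≤ i + 5 := by
  have h1 := length_numCode_le i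
  have h2 := length_numCode_le 0
  simp [letter, formCode, symbolCode]
  have : (numCode 0).length ≤ 2 := h2
  omega

theorem length_lit_le (i : ℕ) (b : Bool) : (formCode (lit i b)).length ≤ 2 * i + 8 := by
  have := length_letter_le (2 * i + 1)
  cases b
  · simp only [lit, formCode, List.length_cons, List.length_append, List.length_nil]
    omega
  · simp only [lit]
    omega

theorem length_clause_le {n : ℕ} (x : Fin n → Bool) :
    (formCode (clause x)).length ≤ n * (2 * n + 10) + 1 := by
  have h : ∀ (m : ℕ) (l : List Sentence), (∀ f ∈ l, (formCode f).length + 1 ≤ m) →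
      (formCode (l.foldr BoundedFormula.imp .falsum)).length ≤ l.length * m + 1 := by
    intro m l hl
    induction l with
    | nil => simp [formCode]
    | cons f l ih =>
      have h1 := ih fun g hg => hl g (List.mem_cons_of_mem _ hg)
      have h2 := hl f (by simp)
      simp only [List.foldr_cons, formCode, List.length_cons, List.length_append, add_mul]
      omega
  refine (h (2 * n + 10) _ fun f hf => ?_).trans (by simp)
  obtain ⟨i, rfl⟩ := (List.mem_ofFn' _ _).1 hf
  have := length_lit_le i (x i)
  have := i.2
  dsimp only
  omega

theorem length_base_le : (formCode base).length ≤ 5 := length_letter_le 0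

theorem length_weak_le (n : ℕ) : (formCode (weak n)).length ≤ 2 * n + 20 := by
  have := length_base_le
  have := length_letter_le (2 * n + 2)
  simp [weak, marker, formCode]
  omega

theorem length_hidden_le {n : ℕ} (x : Fin n → Bool) :
    (formCode (hidden x)).length ≤ n * (2 * n + 10) + 2 * n + 30 := by
  have := length_base_le
  have := length_letter_le (2 * n + 2)
  have := length_clause_le x
  simp [hidden, marker, formCode]
  omega

/-- A literal and its negation use the same letter. Hence the signature handed to the learner tells
nothing about the bits of `x`. -/
theorem formSymbols_hidden {n : ℕ} (x y : Fin n → Bool) :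
    formSymbols (hidden x) = formSymbols (hidden y) := by
  have hlit : ∀ (i : ℕ) (b : Bool), formSymbols (lit i b) = formSymbols (letter (2 * i + 1)) := by
    intro i b
    cases b <;> simp [lit, formSymbols]
  have hfold : ∀ l : List Sentence, formSymbols (l.foldr BoundedFormula.imp .falsum) =
      (l.map fun f => formSymbols f).flatten := by
    intro l
    induction l <;> simp_all [formSymbols]
  simp only [hidden, clause, formSymbols, hfold, List.map_ofFn, Function.comp_def, hlit]

/-! ## The framework -/

open Classical in
/-- The knowledge base `{base, hidden x}`, which is classically equivalent to `{base}`. -/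
noncomputable def concept {n : ℕ} (x : Fin n → Bool) : Finset Sentence := {base, hidden x}

def hiddenHyps : Set (Finset Sentence) :=
  {k | k = {base} ∨ ∃ (n : ℕ) (x : Fin n → Bool), k = concept x}

/-- `hidden x` is a consequence of `base`, so adding it changes nothing classically. -/
theorem foEntails_hiddenHyps_iff {k : Finset Sentence} (hk : k ∈ hiddenHyps) {f : Sentence} :
    FOEntails k f ↔ ∀ I, Holds I base → Holds I f := by
  rw [foEntails_iff]
  refine forall_congr' fun I => imp_congr_left ?_
  rcases hk with rfl | ⟨n, x, rfl⟩
  · simp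
  · simpa [concept, holds_hidden] using Or.inl

/-- The framework whose hypotheses are `{base}` and all `{base, hidden x}`. -/
def hiddenFramework : FOFramework where
  examples := insert base (Set.range weak)
  hyps := hiddenHyps
  examples_nonempty := ⟨base, by simp⟩
  hyps_nonempty := ⟨{base}, .inl rfl⟩
  separated h hh t ht hne := by
    -- Separation is vacuous, because no two hypotheses are inequivalent.
    refine absurd (fun f => ?_) hne
    rw [foEntails_hiddenHyps_iff hh, foEntails_hiddenHyps_iff ht]

theorem hiddenFramework_polyTimeLearnable :
    hiddenFramework.toLearningFramework.PolyTimeLearnable := by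
  let w : Word := formCode base ++ [.sep]
  refine ⟨Machine.const Query w, MvPolynomial.C (w.length + 1), fun t ht s _ eqo _ => ?_⟩
  obtain ⟨h1, h2, h3⟩ := Machine.const_halted
    (hiddenFramework.toLearningFramework.oracle t eqo) (LearningFramework.signatureCode s) w
  refine ⟨w.length + 1, h1, ⟨{base}, .inl rfl, ?_, fun f => ?_⟩, ?_, fun n hn => ?_⟩
  · rw [h2]
    exact ⟨[base], rfl, by simp [LearningFramework.listCode, w]; rfl⟩
  · exact (foEntails_hiddenHyps_iff (.inl rfl)).trans (foEntails_hiddenHyps_iff ht).symm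
  · rw [h3]
    simp
  · simpa using hn

theorem hiddenFramework_entailmentInPTime :
    hiddenFramework.toLearningFramework.EntailmentInPTime := by
  refine ⟨Machine.const Empty [.yes], 2, fun l hl e he w _ => ⟨2, by simp, ?_⟩⟩
  obtain ⟨h1, h2, -⟩ := Machine.const_halted (fun (q : Empty) _ => q.elim)
    (w ++ hiddenFramework.toLearningFramework.code e) [.yes]
  refine ⟨h1, fun _ => h2, fun h => absurd ((foEntails_hiddenHyps_iff hl).2 fun I hI => ?_) h⟩
  rcases he with rfl | ⟨n, rfl⟩
  · exact hI
  · exact (holds_weak I n).2 (.inl hI)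

/-! ## Its possibilistic extension -/

namespace Valuation

noncomputable def one : Valuation := ⟨1, by norm_num, le_rfl, 0, 1, by norm_num⟩

noncomputable def half : Valuation := ⟨1 / 2, by norm_num, by norm_num, 1, 5, by norm_num⟩

theorem eq_one_of_one_le {c : Valuation} (h : (1 : ℝ) ≤ c.1) : c = one :=
  Subtype.ext (le_antisymm c.2.2.1 h)

end Valuation

open PossLearn.Valuation

open Classical in
/-- The target that hides `x` above the level `1 / 2`. -/
noncomputable def target {n : ℕ} (x : Fin n → Bool) : Finset PossFormula :=
  {(base, half), (hidden x, one)}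

open Classical in
/-- What all the targets `target x`, for `x` of length `n`, have in common. -/
noncomputable def common (n : ℕ) : Finset PossFormula := {(base, half), (weak n, one)}

theorem target_mem_possHyps {n : ℕ} (x : Fin n → Bool) : target x ∈ hiddenFramework.possHyps := by
  classical
  refine ⟨concept x, .inr ⟨n, x, rfl⟩, fun f => if f = base then half else one, ?_⟩
  simp [target, concept, Set.image_insert_eq, hidden_ne_base]

theorem fst_eq_of_mem_possHyps {k : Finset PossFormula} (hk : k ∈ hiddenFramework.possHyps)
    {y : PossFormula} (hy : y ∈ k) : y.1 = base ∨ ∃ (m : ℕ) (x : Fin m → Bool), y.1 = hidden x := by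
  obtain ⟨l, hl, v, hv⟩ := hk
  obtain ⟨f, hf, rfl⟩ : y ∈ (fun f => (f, v f)) '' (l : Set Sentence) := hv ▸ hy
  rcases hl with rfl | ⟨m, x, rfl⟩
  · exact .inl (by simpa using hf)
  · have : f = base ∨ f = hidden x := by simpa [concept] using hf
    exact this.imp id fun h => ⟨m, x, h⟩

/-! ### Entailment from the targets and from their common part -/

theorem possEntails_target_iff {n : ℕ} {x : Fin n → Bool} {f : Sentence} {c : Valuation} :
    PossEntails (target x) (f, c) ↔
      ∀ I, ¬ Holds I f → c.1 ≤ 1 / 2 ∧ ¬ Holds I base ∨ ¬ Holds I (hidden x) := by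
  rw [possEntails_iff]
  simp [target, half, one, c.2.2.1]

theorem possEntails_common_iff {n : ℕ} {f : Sentence} {c : Valuation} :
    PossEntails (common n) (f, c) ↔
      ∀ I, ¬ Holds I f → c.1 ≤ 1 / 2 ∧ ¬ Holds I base ∨ ¬ Holds I (weak n) := by
  rw [possEntails_iff]
  simp [common, half, one, c.2.2.1]

theorem holds_weak_of_hidden {I : Interp} {n : ℕ} {x : Fin n → Bool} (h : Holds I (hidden x)) :
    Holds I (weak n) :=
  (holds_weak I n).2 (((holds_hidden I x).1 h).imp_right And.left)

theorem PossEntails.target_of_common {n : ℕ} {z : PossFormula} (h : PossEntails (common n) z)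
    (x : Fin n → Bool) : PossEntails (target x) z :=
  possEntails_target_iff.2 fun I hI =>
    (possEntails_common_iff.1 h I hI).imp_right fun hw hh => hw (holds_weak_of_hidden hh)

/-- Take an interpretation witnessing that `common n` does not entail `z`. A target that does entail
`z` must have its hidden sentence false there; as `weak n` is true there, `base` is false, the
marker is true, and the interpretation has the bits of that target. -/
theorem eq_of_possEntails_target {n : ℕ} {z : PossFormula} (h : ¬ PossEntails (common n) z)
    {x y : Fin n → Bool} (hx : PossEntails (target x) z) (hy : PossEntails (target y) z) :
    x = y := by
  obtain ⟨f, c⟩ := z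
  rw [possEntails_common_iff] at h
  push Not at h
  obtain ⟨I, hI, h1, h2⟩ := h
  have key : ∀ x : Fin n → Bool, PossEntails (target x) (f, c) → HasBits I x := by
    intro x hx
    rcases possEntails_target_iff.1 hx I hI with ⟨hc, hb⟩ | hh
    · exact absurd (h1 hc) hb
    · rw [holds_hidden, not_or, not_and, not_not] at hh
      exact hh.2 (((holds_weak I n).1 h2).resolve_left hh.1)
  exact (key x hx).unique (key y hy)

/-- At level 1 the copy of `base` with valuation 1/2 is useless, so `hidden x` itself must fail in
an interpretation with false base, true markers and the bits of `y`. -/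
theorem eq_of_possEntails_target_hidden {n : ℕ} {x y : Fin n → Bool}
    (h : PossEntails (target x) (hidden y, one)) : x = y := by
  obtain ⟨I, h1, h2, h3⟩ := exists_interp_hasBits y
  rcases possEntails_target_iff.1 h I (by simp [holds_hidden, h1, h3]) with ⟨hc, -⟩ | hh
  · norm_num [one] at hc
  · rw [holds_hidden, not_or, not_and, not_not] at hh
    exact (hh.2 (h2 n)).unique h3

theorem not_possEntails_target_base {n : ℕ} (hn : 0 < n) (x : Fin n → Bool) :
    ¬ PossEntails (target x) (base, one) := by
  intro h
  -- `base` at level 1 would yield every `hidden y` at level 1; for `n > 0` there are two different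
  -- `y`.
  have key : ∀ y, x = y := fun y => eq_of_possEntails_target_hidden <| by
    refine possEntails_target_iff.2 fun I hI => ?_
    refine possEntails_target_iff.1 h I fun hb => hI ((holds_hidden I y).2 (.inl hb))
  have := congrFun ((key fun _ => true).symm.trans (key fun _ => false)) ⟨0, hn⟩
  simp at this

/-! ### Equivalence queries answered without regard to the target -/

theorem exists_hidden_mem {k : Finset PossFormula} (hk : k ∈ hiddenFramework.possHyps) {n : ℕ}
    (hb : ¬ PossEntails k (base, one)) (hw : PossEntails k (weak n, one)) :
    ∃ y : Fin n → Bool, (hidden y, one) ∈ k := by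
  rw [possEntails_iff] at hb
  push Not at hb
  obtain ⟨I, hI, hIk⟩ := hb
  -- In `I` the base is false and all members of `k` at level 1 are true. `J` keeps the bits of `I`
  -- and makes `marker n` the only false marker, so `weak n` fails and some member at level 1 fails
  -- with it.
  obtain ⟨J, hJ, hJm, hJb⟩ := exists_interp (fun m => m ≠ n) fun i => Holds I (letter (2 * i + 1))
  obtain ⟨⟨f, c⟩, hy, hc, hyJ⟩ := possEntails_iff.1 hw J (by simp [holds_weak, hJ, hJm])
  have hyI := hIk _ hy hc
  rcases fst_eq_of_mem_possHyps hk hy with rfl | ⟨m, x, rfl⟩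
  · exact absurd hyI hI
  · have hbits : HasBits J x ↔ HasBits I x := by simp only [HasBits, hJb]
    simp only [holds_hidden, hJm, hbits] at hyI hyJ
    -- For `m ≠ n` the marker is true in `J`, and the clause holds in `J` as it does in `I`, so
    -- `hidden x` could not fail in `J`.
    obtain rfl : m = n := by
      by_contra hmn
      tauto
    exact ⟨x, eq_one_of_one_le hc ▸ hy⟩

open Classical in
/-- The counterexample that does not depend on the target. -/
noncomputable def commonAnswer (n : ℕ) (h : Finset PossFormula) : PossFormula :=
  if PossEntails h (base, one) then (base, one)
  else if PossEntails h (weak n, one) then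
    -- The inner default is never used for an `h` in the hypothesis space, by `exists_hidden_mem`.
    if hy : ∃ y : Fin n → Bool, (hidden y, one) ∈ h then (hidden hy.choose, one) else (base, one)
  else (weak n, one)

theorem possEntails_target_weak {n : ℕ} (x : Fin n → Bool) :
    PossEntails (target x) (weak n, one) :=
  possEntails_target_iff.2 fun _ hI => .inr fun hh => hI (holds_weak_of_hidden hh)

/-- No target entails `base` at level 1 and every target entails `weak n` at level 1, so these two
answers suit all targets. A hypothesis that agrees with the targets on both contains some `hidden y`
at level 1, which no target other than `target y` entails. All answers are examples for every
admissible `L`, being in the original example set or in a hypothesis. -/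
theorem not_isCounterexample_commonAnswer {L : Set Sentence} {hL : hiddenFramework.InLanguage L}
    {n : ℕ} (hn : 0 < n) {x : Fin n → Bool} {h : Finset PossFormula}
    (hh : h ∈ hiddenFramework.possHyps)
    (hne : ¬ (hiddenFramework.possExt L hL).IsCounterexample (target x) h (commonAnswer n h)) :
    commonAnswer n h = (hidden x, one) := by
  by_cases hb : PossEntails h (base, one)
  · refine absurd ⟨?_, .inr ⟨?_, ?_⟩⟩ hne <;> simp only [commonAnswer, if_pos hb]
    · exact ⟨hL.1 (by simp [hiddenFramework]), h, hh, hb⟩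
    · exact hb
    · exact not_possEntails_target_base hn x
  by_cases hw : PossEntails h (weak n, one)
  · have hy := exists_hidden_mem hh hb hw
    have he : commonAnswer n h = (hidden hy.choose, one) := by
      simp only [commonAnswer, if_neg hb, if_pos hw, dif_pos hy]
    have hm := hy.choose_spec
    generalize hy.choose = y at he hm
    rw [he] at hne ⊢
    by_contra hxy
    refine hne ⟨FOFramework.mem_possExamples_of_mem _ hL hh hm,
      .inr ⟨FOFramework.PossEntails.of_mem hm, fun ht => ?_⟩⟩
    rw [eq_of_possEntails_target_hidden ht] at hxy
    exact hxy rfl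
  · refine absurd ⟨?_, .inl ⟨?_, ?_⟩⟩ hne <;> simp only [commonAnswer, if_neg hb, if_neg hw]
    · exact ⟨hL.1 (by simp [hiddenFramework]), _, target_mem_possHyps x, possEntails_target_weak x⟩
    · exact possEntails_target_weak x
    · exact hw

/-- The equivalence oracle for `target x` that gives the common answer if it can. -/
noncomputable def targetAnswer {L : Set Sentence} (hL : hiddenFramework.InLanguage L) {n : ℕ}
    (x : Fin n → Bool) : Finset PossFormula → Option PossFormula :=
  (hiddenFramework.possExt L hL).preferredAnswer (target x) (commonAnswer n)

theorem isEQOracle_targetAnswer {L : Set Sentence} (hL : hiddenFramework.InLanguage L) {n : ℕ}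
    (x : Fin n → Bool) :
    (hiddenFramework.possExt L hL).IsEQOracle (target x) (targetAnswer hL x) :=
  LearningFramework.isEQOracle_preferredAnswer (F := hiddenFramework.possExt L hL)
    (target_mem_possHyps x) (commonAnswer n)

/-- A query tells at most one of the targets from their common part. -/
theorem eq_of_oracle_ne {L : Set Sentence} (hL : hiddenFramework.InLanguage L) {n : ℕ} (hn : 0 < n)
    (q : Query) (w : Word) (x y : Fin n → Bool)
    (hx : (hiddenFramework.possExt L hL).oracle (target x) (targetAnswer hL x) q w ≠
      (hiddenFramework.possExt L hL).oracle (common n) (some ∘ commonAnswer n) q w)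
    (hy : (hiddenFramework.possExt L hL).oracle (target y) (targetAnswer hL y) q w ≠
      (hiddenFramework.possExt L hL).oracle (common n) (some ∘ commonAnswer n) q w) : x = y := by
  cases q with
  | mem =>
    -- Targets entail whatever `common n` entails, so a differing reply means that the target
    -- entails strictly more at this query.
    have key : ∀ x : Fin n → Bool,
        (hiddenFramework.possExt L hL).oracle (target x) (targetAnswer hL x) .mem w ≠
          (hiddenFramework.possExt L hL).oracle (common n) (some ∘ commonAnswer n) .mem w →
        ∃ e, (hiddenFramework.possExt L hL).code e = w ∧ PossEntails (target x) e ∧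
          ¬ PossEntails (common n) e := by
      intro x hx
      by_contra! hcon
      exact hx (LearningFramework.oracle_mem_congr fun e he =>
        ⟨hcon e he, fun h => PossEntails.target_of_common h x⟩)
    obtain ⟨e, he, h1, h2⟩ := key x hx
    obtain ⟨e', he', h1', -⟩ := key y hy
    obtain rfl := (hiddenFramework.possExt L hL).code_injective (he.trans he'.symm)
    exact eq_of_possEntails_target h2 h1 h1'
  | eq =>
    have key : ∀ x : Fin n → Bool,
        (hiddenFramework.possExt L hL).oracle (target x) (targetAnswer hL x) .eq w ≠
          (hiddenFramework.possExt L hL).oracle (common n) (some ∘ commonAnswer n) .eq w →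
        ∃ k, (hiddenFramework.possExt L hL).Codes w k ∧ commonAnswer n k = (hidden x, one) := by
      intro x hx
      by_contra! hcon
      refine hx (LearningFramework.oracle_eq_congr fun k hk hw => ?_)
      refine LearningFramework.preferredAnswer_of_isCounterexample ?_
      by_contra hce
      exact hcon k hw (not_isCounterexample_commonAnswer hn hk hce)
    obtain ⟨k, hk, hkx⟩ := key x hx
    obtain ⟨k', hk', hky⟩ := key y hy
    obtain rfl := LearningFramework.Codes.unique _ hk hk'
    -- The two hidden formulas coincide; that their strings coincide is read off semantically.
    refine eq_of_possEntails_target_hidden (x := x) ?_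
    rw [← hky, hkx]
    exact FOFramework.PossEntails.of_mem (by simp [target])

/-! ### Bounds on sizes -/

/-- A bound on the sizes of the targets and of the common answers. -/
noncomputable def sizeBound : Polynomial ℕ :=
  .X * (2 * .X + 10) + 2 * .X + .C (60 + half.code.length + one.code.length)

theorem eval_sizeBound (n : ℕ) : sizeBound.eval n =
    n * (2 * n + 10) + 2 * n + (60 + half.code.length + one.code.length) := by
  simp [sizeBound]

theorem size_target_le {L : Set Sentence} (hL : hiddenFramework.InLanguage L) {n : ℕ}
    (x : Fin n → Bool) :
    (hiddenFramework.possExt L hL).size (target x) ≤ sizeBound.eval n := by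
  classical
  have hne : ((base, half) : PossFormula) ≠ (hidden x, one) := fun h =>
    hidden_ne_base x (congrArg Prod.fst h).symm
  have hsum : (hiddenFramework.possExt L hL).size (target x) =
      ((formCode base ++ half.code).length + 1) + ((formCode (hidden x) ++ one.code).length + 1) :=
    Finset.sum_pair (ι := PossFormula) hne
  have := length_base_le
  have := length_hidden_le x
  rw [hsum, eval_sizeBound, List.length_append, List.length_append]
  omega

theorem length_commonAnswer_le (n : ℕ) (h : Finset PossFormula) :
    (formCode (commonAnswer n h).1 ++ (commonAnswer n h).2.code).length ≤ sizeBound.eval n := by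
  have h1 := length_base_le
  have h2 := length_weak_le n
  rw [eval_sizeBound, List.length_append]
  unfold commonAnswer
  split_ifs with _ _ hy
  · dsimp only; omega
  · have := length_hidden_le hy.choose
    dsimp only; omega
  · dsimp only; omega
  · dsimp only; omega

theorem exists_listsSignature {L : Set Sentence} (hL : hiddenFramework.InLanguage L) (n : ℕ) :
    ∃ s, ∀ x : Fin n → Bool, (hiddenFramework.possExt L hL).ListsSignature s (target x) := by
  classical
  refine ⟨(formSymbols base ++ formSymbols (hidden fun _ : Fin n => false)).dedup, fun x =>
    ⟨List.nodup_dedup _, fun a => ?_⟩⟩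
  rw [List.mem_dedup, List.mem_append, ← formSymbols_hidden x]
  change _ ↔ ∃ f ∈ target x, a ∈ formSymbols f.1
  simp [target]

theorem not_polyTimeLearnable_possExt {L : Set Sentence} (hL : hiddenFramework.InLanguage L) :
    ¬ (hiddenFramework.possExt L hL).PolyTimeLearnable := by
  rintro ⟨M, p, hM⟩
  -- `sizeBound` replaces both arguments of the time bound, since it bounds the targets as well as
  -- the adversary's counterexamples. The `2` is the slack required by
  -- `IsPolyLearner.exists_equivalent`, and `2 ^ n` is the number of targets.
  obtain ⟨n, hn⟩ := Polynomial.exists_eval_lt_two_pow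
    (MvPolynomial.aeval (fun _ => sizeBound) p + 2)
  have heval : (MvPolynomial.aeval (fun _ : Fin 2 => sizeBound) p).eval n =
      MvPolynomial.eval ![sizeBound.eval n, sizeBound.eval n] p := by
    have hv : ![sizeBound.eval n, sizeBound.eval n] = fun _ => sizeBound.eval n := by
      ext i
      fin_cases i <;> rfl
    rw [hv]
    clear hM hn
    induction p using MvPolynomial.induction_on <;> simp_all
  rw [Polynomial.eval_add, heval] at hn
  have hn0 : 0 < n := by
    rcases Nat.eq_zero_or_pos n with rfl | h
    · simp at hn
    · exact h
  obtain ⟨s, hs⟩ := exists_listsSignature hL n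
  have hB : ∀ k e, some (commonAnswer n k) = some e →
      ((hiddenFramework.possExt L hL).code e).length ≤ sizeBound.eval n := by
    rintro k e ⟨⟩
    exact length_commonAnswer_le n k
  obtain ⟨x, y, hxy, heq⟩ := hM.exists_equivalent (eqo := fun x => targetAnswer hL x)
    (O := (hiddenFramework.possExt L hL).oracle (common n) (some ∘ commonAnswer n))
    (B := sizeBound.eval n)
    target_mem_possHyps hs (isEQOracle_targetAnswer hL)
    (size_target_le hL) (LearningFramework.length_oracle_eq_le hB)
    (eq_of_oracle_ne hL hn0) (by simpa using hn)
  refine hxy (eq_of_possEntails_target_hidden ((heq _).2 ?_))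
  exact FOFramework.PossEntails.of_mem (by simp [target])

end PossLearn

theorem theoremt :
    ∃ F : FOFramework, F.toLearningFramework.InPTimeL ∧
      ∀ (L : Set Sentence) (hL : F.InLanguage L),
        ¬ (F.possExt L hL).InPTimeL ∧ ¬ (F.possExt L hL).PolyTimeLearnable :=
  ⟨hiddenFramework, ⟨hiddenFramework_polyTimeLearnable, hiddenFramework_entailmentInPTime⟩,
    fun _ hL => ⟨fun h => not_polyTimeLearnable_possExt hL h.1, not_polyTimeLearnable_possExt hL⟩⟩
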